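/- For a finite simple graph $G$ on vertex set $V(G)$, let $\mathcal{S}(G)$ be the set of real symmetric matrices $A=[a_{ij}]$, with rows and columns indexed by $V(G)$, such that for $i\neq j$, $a_{ij}\neq 0$ if and only if $ij\in E(G)$ (the diagonal entries are unrestricted). Let $q(A)$ denote the number of distinct eigenvalues of $A$, and let $q(G)=\min\{q(A): A\in\mathcal{S}(G)\}$. The strong product $G\boxtimes G'$ has vertex set $V(G)\times V(G')$, and $(u,u')$ and $(v,v')$ are adjacent if and only if one of the following holds: $u=v$ and $u'v'\in E(G')$; or $u'=v'$ and $uv\in E(G)$; or $uv\in E(G)$ and $u'v'\in E(G')$. Let $P_n$ denote the path on $n$ vertices. Then for all integers $s'\ge s\ge 2$, \[ s\;\le\; q(P_s\boxtimes P_{s'})\;\le\; \begin{cases} s+s'-2 & \text{if } s \text{ and } s' \text{ are both even},\\ s+s'-1 & \text{otherwise.} \end{cases} \] -/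

import Mathlib

namespace SimpleGraph

/-- The strong product `G ⊠ G'`. -/
def strongProd {V W : Type*} (G : SimpleGraph V) (G' : SimpleGraph W) : SimpleGraph (V × W) where
  Adj x y := (x.1 = y.1 ∧ G'.Adj x.2 y.2) ∨ (x.2 = y.2 ∧ G.Adj x.1 y.1) ∨
    (G'.Adj x.2 y.2 ∧ G.Adj x.1 y.1)
  symm := ⟨by
    rintro x y (⟨h, h'⟩ | ⟨h, h'⟩ | ⟨h, h'⟩)
    · exact Or.inl ⟨h.symm, h'.symm⟩
    · exact Or.inr (Or.inl ⟨h.symm, h'.symm⟩)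
    · exact Or.inr (Or.inr ⟨h.symm, h'.symm⟩)⟩
  loopless := ⟨by
    rintro x (⟨-, h⟩ | ⟨-, h⟩ | ⟨-, h⟩) <;> exact h.ne rfl⟩

/-- The set `S(G)` of real symmetric matrices whose off-diagonal nonzero pattern is given by the
edges of `G`; the diagonal is unrestricted. -/
def symmMatrices {V : Type*} (G : SimpleGraph V) : Set (Matrix V V ℝ) :=
  {A | A.IsSymm ∧ ∀ i j, i ≠ j → (A i j ≠ 0 ↔ G.Adj i j)}

end SimpleGraph

/-- The set of distinct (real) eigenvalues of a real square matrix. -/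
def Matrix.distinctEigenvalues {V : Type*} [Fintype V] [DecidableEq V] (A : Matrix V V ℝ) : Set ℝ :=
  {μ | Module.End.HasEigenvalue (Matrix.toLin' A) μ}

/-- The number `q(A)` of distinct eigenvalues of `A`. -/
noncomputable def Matrix.numDistinctEigenvalues {V : Type*} [Fintype V] [DecidableEq V]
    (A : Matrix V V ℝ) : ℕ :=
  A.distinctEigenvalues.ncard

/-- `q(A)` is an honest count: the set of distinct eigenvalues is finite. -/
theorem Matrix.finite_distinctEigenvalues {V : Type*} [Fintype V] [DecidableEq V]
    (A : Matrix V V ℝ) : A.distinctEigenvalues.Finite :=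
  Module.End.finite_hasEigenvalue (Matrix.toLin' A)

namespace SimpleGraph

/-- The minimum number `q(G)` of distinct eigenvalues over all matrices in `S(G)`. -/
noncomputable def minDistinctEigenvalues {V : Type*} [Fintype V] [DecidableEq V]
    (G : SimpleGraph V) : ℕ :=
  sInf {k | ∃ A ∈ G.symmMatrices, A.numDistinctEigenvalues = k}

/-- `S(G)` is nonempty: it contains the adjacency matrix. -/
theorem symmMatrices_nonempty {V : Type*} (G : SimpleGraph V) : G.symmMatrices.Nonempty := by
  classical
  refine ⟨G.adjMatrix ℝ, G.isSymm_adjMatrix, fun i j _ => ?_⟩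
  simp [SimpleGraph.adjMatrix_apply]

/-- The infimum defining `q(G)` is an attained minimum. -/
theorem isLeast_minDistinctEigenvalues {V : Type*} [Fintype V] [DecidableEq V]
    (G : SimpleGraph V) :
    IsLeast {k | ∃ A ∈ G.symmMatrices, A.numDistinctEigenvalues = k} G.minDistinctEigenvalues := by
  obtain ⟨A, hA⟩ := G.symmMatrices_nonempty
  exact ⟨Nat.sInf_mem ⟨_, A, hA, rfl⟩, fun _ hk => Nat.sInf_le hk⟩

end SimpleGraph

/-! Lower bound: in `P_s ⊠ P_{s'}` the only walk of length `m` from the corner `(0,0)` to `(m,m)` is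
the diagonal one, and no shorter walk arrives. So for `m < s` the entry of `A ^ m` there is nonzero
while lower powers vanish there, and no monic polynomial of degree `m` kills `A`
(`pow_apply_diag_ne_zero`). A symmetric matrix is killed by the product of `X - C μ` over its
distinct eigenvalues, so there are at least `s` of these.

Upper bound: if `A` and `B` are path matrices with nowhere zero diagonals, `A ⊗ₖ B` has the pattern
of the strong product, and its eigenvalues are products of theirs. Spectra `2 ^ i` give `s + s' - 1`
products; for even orders, spectra `±2 ^ a` give `s + s' - 2`. Path matrices with given spectrum are
Jacobi matrices of discrete measures; `exists_weights` picks the weights so that the diagonal does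
not vanish. -/

open Polynomial Finset Matrix Kronecker

/-! ### Discrete orthogonal polynomials -/

namespace DiscreteOrthogonal

/-- The bilinear form of the discrete measure with weight `w i` at the point `x i`, `i < N`. -/
noncomputable def form (x w : ℕ → ℝ) (N : ℕ) (f g : ℝ[X]) : ℝ :=
  ∑ i ∈ range N, w i * (f.eval (x i) * g.eval (x i))

/-- The Rayleigh quotient of multiplication by `X` at `f`. -/
noncomputable def rayleigh (x w : ℕ → ℝ) (N : ℕ) (f : ℝ[X]) : ℝ :=
  form x w N (X * f) f / form x w N f f

/-- The monic orthogonal polynomials, defined by their three-term recurrence. -/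
noncomputable def orthPoly (x w : ℕ → ℝ) (N : ℕ) : ℕ → ℝ[X]
  | 0 => 1
  | 1 => X - C (rayleigh x w N 1)
  | k + 2 => (X - C (rayleigh x w N (orthPoly x w N (k + 1)))) * orthPoly x w N (k + 1) -
      C (form x w N (orthPoly x w N (k + 1)) (orthPoly x w N (k + 1)) /
        form x w N (orthPoly x w N k) (orthPoly x w N k)) * orthPoly x w N k

variable {x w : ℕ → ℝ} {N : ℕ}

lemma form_comm (f g : ℝ[X]) : form x w N f g = form x w N g f := by
  simp only [form, mul_comm]

lemma form_add_left (f g k : ℝ[X]) :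
    form x w N (f + g) k = form x w N f k + form x w N g k := by
  simp only [form, eval_add, ← sum_add_distrib]
  exact sum_congr rfl fun i _ => by ring

lemma form_sub_left (f g k : ℝ[X]) :
    form x w N (f - g) k = form x w N f k - form x w N g k := by
  simp only [form, eval_sub, ← sum_sub_distrib]
  exact sum_congr rfl fun i _ => by ring

lemma form_C_mul_left (c : ℝ) (f g : ℝ[X]) :
    form x w N (C c * f) g = c * form x w N f g := by
  simp only [form, eval_mul, eval_C, mul_sum]
  exact sum_congr rfl fun i _ => by ring

lemma form_X_mul_comm (f g : ℝ[X]) :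
    form x w N (X * f) g = form x w N (X * g) f := by
  simp only [form, eval_mul, eval_X]
  exact sum_congr rfl fun i _ => by ring

lemma orthPoly_monic_natDegree (k : ℕ) :
    (orthPoly x w N k).Monic ∧ (orthPoly x w N k).natDegree = k := by
  induction k using Nat.strong_induction_on with
  | _ k ih =>
    match k with
    | 0 => simp [orthPoly]
    | 1 => simpa [orthPoly] using monic_X_sub_C _
    | k + 2 =>
      obtain ⟨h1, d1⟩ := ih (k + 1) (by omega)
      obtain ⟨h0, d0⟩ := ih k (by omega)
      rw [orthPoly]
      set p := orthPoly x w N (k + 1)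
      set q := orthPoly x w N k
      set a := rayleigh x w N p
      set c := form x w N p p / form x w N q q
      have hm : ((X - C a) * p).Monic := (monic_X_sub_C a).mul h1
      have hd : ((X - C a) * p).natDegree = k + 2 := by
        rw [(monic_X_sub_C a).natDegree_mul h1, natDegree_X_sub_C, d1]; omega
      have hq : (C c * q).natDegree ≤ k := (natDegree_C_mul_le _ _).trans d0.le
      have hlt : (C c * q).degree < ((X - C a) * p).degree := by
        rw [degree_eq_natDegree hm.ne_zero, hd]
        exact degree_le_natDegree.trans_lt (by exact_mod_cast hq.trans_lt (by omega))
      refine ⟨hm.sub_of_left hlt, ?_⟩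
      rw [natDegree_sub_eq_left_of_natDegree_lt (by omega), hd]

/-- A nonzero polynomial of degree `k < n` cannot vanish at all `n` nodes of positive weight. -/
lemma form_orthPoly_self_pos {n k : ℕ} (hx : Function.Injective x) (hn : n ≤ N)
    (hw : ∀ i, 0 ≤ w i) (hpos : ∀ i < n, 0 < w i) (hk : k < n) :
    0 < form x w N (orthPoly x w N k) (orthPoly x w N k) := by
  obtain ⟨hm, hd⟩ := orthPoly_monic_natDegree (x := x) (w := w) (N := N) k
  set p := orthPoly x w N k
  have hnn : ∀ i ∈ range N, 0 ≤ w i * (p.eval (x i) * p.eval (x i)) := fun i _ =>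
    mul_nonneg (hw i) (mul_self_nonneg _)
  refine lt_of_le_of_ne (sum_nonneg hnn) fun h => hm.ne_zero ?_
  have h0 := (sum_eq_zero_iff_of_nonneg hnn).1 h.symm
  refine eq_zero_of_natDegree_lt_card_of_eval_eq_zero' p ((range n).image x) ?_ ?_
  · simp only [mem_image, mem_range]
    rintro _ ⟨i, hi, rfl⟩
    have := h0 i (mem_range.2 (hi.trans_le hn))
    simpa [(hpos i hi).ne'] using this
  · rw [card_image_of_injective _ hx, card_range, hd]
    exact hk

lemma exists_X_mul_orthPoly (k : ℕ) : ∃ c : ℝ, (k = 0 → c = 0) ∧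
    X * orthPoly x w N k = orthPoly x w N (k + 1) +
      C (rayleigh x w N (orthPoly x w N k)) * orthPoly x w N k + C c * orthPoly x w N (k - 1) := by
  match k with
  | 0 => exact ⟨0, fun _ => rfl, by simp [orthPoly]⟩
  | k + 1 =>
    refine ⟨form x w N (orthPoly x w N (k + 1)) (orthPoly x w N (k + 1)) /
        form x w N (orthPoly x w N k) (orthPoly x w N k), by simp, ?_⟩
    rw [orthPoly, Nat.add_sub_cancel]
    ring

/-- The recurrence for degree `n` divides only by norms of lower degree, so the case `k = n` is
covered even if that polynomial has norm zero. -/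
lemma form_orthPoly_eq_zero {n : ℕ}
    (hne : ∀ k < n, form x w N (orthPoly x w N k) (orthPoly x w N k) ≠ 0) :
    ∀ k ≤ n, ∀ j < k, form x w N (orthPoly x w N k) (orthPoly x w N j) = 0 := by
  intro k
  induction k using Nat.strong_induction_on with
  | _ k ih =>
    intro hk j hj
    match k with
    | 0 => omega
    | 1 =>
      obtain rfl : j = 0 := by omega
      have h0 := hne 0 (by omega)
      simp only [orthPoly] at h0 ⊢
      have := form_C_mul_left (x := x) (w := w) (N := N) (rayleigh x w N 1) 1 1
      rw [mul_one] at this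
      rw [form_sub_left, this, rayleigh, div_mul_cancel₀ _ h0, mul_one, sub_self]
    | k + 2 =>
      have h1 := hne (k + 1) (by omega)
      have h0 := hne k (by omega)
      have ih1 := ih (k + 1) (by omega) (by omega)
      rw [orthPoly, form_sub_left, sub_mul, form_sub_left, form_C_mul_left, form_C_mul_left]
      rcases (by omega : j = k + 1 ∨ j = k ∨ j < k) with rfl | rfl | hjk
      · rw [form_comm (orthPoly x w N k) (orthPoly x w N (k + 1)), ih1 k (by omega), rayleigh, div_mul_cancel₀ _ h1]
        ring
      -- Moving `X` to the other factor and expanding leaves the squared norm in degree `j + 1`,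
      -- which the second recurrence coefficient is designed to cancel.
      · rw [ih1 j (by omega), div_mul_cancel₀ _ h0, form_X_mul_comm]
        obtain ⟨c, hc, h⟩ := exists_X_mul_orthPoly (x := x) (w := w) (N := N) j
        rw [h, form_add_left, form_add_left, form_C_mul_left, form_C_mul_left,
          form_comm (orthPoly x w N j), ih1 j (by omega), form_comm (orthPoly x w N (j - 1)),
          ih1 (j - 1) (by omega)]
        ring
      · rw [ih1 j (by omega), ih k (by omega) (by omega) j hjk, form_X_mul_comm]
        obtain ⟨c, hc, h⟩ := exists_X_mul_orthPoly (x := x) (w := w) (N := N) j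
        rw [h, form_add_left, form_add_left, form_C_mul_left, form_C_mul_left,
          form_comm (orthPoly x w N j), ih1 j (by omega), form_comm (orthPoly x w N (j - 1)),
          ih1 (j - 1) (by omega), form_comm (orthPoly x w N (j + 1)), ih1 (j + 1) (by omega)]
        ring

lemma form_orthPoly_ne {n : ℕ}
    (hne : ∀ k < n, form x w N (orthPoly x w N k) (orthPoly x w N k) ≠ 0) {j k : ℕ} (hj : j ≤ n)
    (hk : k ≤ n) (hjk : j ≠ k) : form x w N (orthPoly x w N j) (orthPoly x w N k) = 0 := by
  rcases hjk.lt_or_gt with h | h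
  · rw [form_comm, form_orthPoly_eq_zero hne k hk j h]
  · exact form_orthPoly_eq_zero hne j hj k h

lemma form_X_mul_orthPoly_succ {n k : ℕ}
    (hne : ∀ k < n, form x w N (orthPoly x w N k) (orthPoly x w N k) ≠ 0) (hk : k + 1 ≤ n) :
    form x w N (X * orthPoly x w N k) (orthPoly x w N (k + 1)) =
      form x w N (orthPoly x w N (k + 1)) (orthPoly x w N (k + 1)) := by
  obtain ⟨c, hc, h⟩ := exists_X_mul_orthPoly (x := x) (w := w) (N := N) k
  rw [h, form_add_left, form_add_left, form_C_mul_left, form_C_mul_left,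
    form_orthPoly_ne hne (by omega) hk (by omega : k ≠ k + 1),
    form_orthPoly_ne hne (by omega) hk (by omega : k - 1 ≠ k + 1)]
  ring

lemma form_X_mul_orthPoly_eq_zero {n k l : ℕ}
    (hne : ∀ k < n, form x w N (orthPoly x w N k) (orthPoly x w N k) ≠ 0) (hkl : k + 1 < l)
    (hl : l ≤ n) : form x w N (X * orthPoly x w N k) (orthPoly x w N l) = 0 := by
  obtain ⟨c, hc, h⟩ := exists_X_mul_orthPoly (x := x) (w := w) (N := N) k
  rw [h, form_add_left, form_add_left, form_C_mul_left, form_C_mul_left,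
    form_orthPoly_ne hne (by omega) hl (by omega : k ≠ l),
    form_orthPoly_ne hne (by omega) hl (by omega : k + 1 ≠ l),
    form_orthPoly_ne hne (by omega) hl (by omega : k - 1 ≠ l)]
  ring

/-! ### The associated Jacobi matrix -/

/-- The orthogonal matrix of normalized values of the orthogonal polynomials. -/
noncomputable def basisMatrix (x w : ℕ → ℝ) (N n : ℕ) : Matrix (Fin n) (Fin n) ℝ :=
  .of fun i k => √(w i) * (orthPoly x w N k).eval (x i) /
    √(form x w N (orthPoly x w N k) (orthPoly x w N k))

/-- `N` stays fixed while nodes are activated one by one: only the first `n` carry weight. -/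
lemma form_eq_sum_fin {n : ℕ} (hn : n ≤ N) (hzero : ∀ i, n ≤ i → w i = 0) (f g : ℝ[X]) :
    form x w N f g = ∑ i : Fin n, w i * (f.eval (x i) * g.eval (x i)) := by
  rw [form, Fin.sum_univ_eq_sum_range (fun i => w i * (f.eval (x i) * g.eval (x i)))]
  refine (sum_subset (range_subset_range.2 hn) fun i _ hi => ?_).symm
  rw [hzero i (by simpa using hi), zero_mul]

lemma basisMatrix_transpose_mul {n : ℕ} (hx : Function.Injective x) (hn : n ≤ N)
    (hpos : ∀ i < n, 0 < w i) (hzero : ∀ i, n ≤ i → w i = 0) :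
    (basisMatrix x w N n)ᵀ * basisMatrix x w N n = 1 := by
  have hw : ∀ i, 0 ≤ w i := fun i =>
    (lt_or_ge i n).elim (fun h => (hpos i h).le) fun h => (hzero i h).ge
  have hp := fun k hk => form_orthPoly_self_pos (k := k) hx hn hw hpos hk
  ext k l
  have key : ((basisMatrix x w N n)ᵀ * basisMatrix x w N n) k l =
      form x w N (orthPoly x w N k) (orthPoly x w N l) /
      (√(form x w N (orthPoly x w N k) (orthPoly x w N k)) *
        √(form x w N (orthPoly x w N l) (orthPoly x w N l))) := by
    rw [mul_apply, form_eq_sum_fin hn hzero (orthPoly x w N k) (orthPoly x w N l), sum_div]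
    refine sum_congr rfl fun i _ => ?_
    simp only [transpose_apply, basisMatrix, of_apply]
    rw [div_mul_div_comm]
    congr 1
    -- The first two occurrences of `w i` are already under square roots; only the third is split.
    nth_rewrite 3 [← Real.mul_self_sqrt (hw i)]
    ring
  rw [key]
  by_cases hkl : k = l
  · subst hkl
    rw [Real.mul_self_sqrt (hp k k.2).le, div_self (hp k k.2).ne', one_apply_eq]
  · rw [one_apply_ne hkl, form_orthPoly_ne (fun k hk => (hp k hk).ne') k.2.le l.2.le
      (fun h => hkl (Fin.ext h)), zero_div]

/-- This is multiplication by `X` in the orthonormal polynomial basis: the three-term recurrence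
makes it tridiagonal, with Rayleigh quotients on the diagonal. -/
lemma basisMatrix_conj_apply {n : ℕ} (hw : ∀ i, 0 ≤ w i) (hn : n ≤ N)
    (hzero : ∀ i, n ≤ i → w i = 0) (k l : Fin n) :
    ((basisMatrix x w N n)ᵀ * diagonal (fun i : Fin n => x i) * basisMatrix x w N n) k l =
      form x w N (X * orthPoly x w N k) (orthPoly x w N l) /
      (√(form x w N (orthPoly x w N k) (orthPoly x w N k)) *
        √(form x w N (orthPoly x w N l) (orthPoly x w N l))) := by
  rw [mul_apply, form_eq_sum_fin hn hzero (X * orthPoly x w N k) (orthPoly x w N l), sum_div]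
  refine sum_congr rfl fun i _ => ?_
  rw [mul_diagonal]
  simp only [transpose_apply, basisMatrix, of_apply, eval_mul, eval_X]
  rw [div_mul_eq_mul_div, div_mul_div_comm]
  congr 1
  nth_rewrite 3 [← Real.mul_self_sqrt (hw i)]
  ring

/-- Both sides are the trace of the same matrix, before and after orthogonal conjugation. -/
lemma sum_rayleigh_orthPoly {n : ℕ} (hx : Function.Injective x) (hn : n ≤ N)
    (hpos : ∀ i < n, 0 < w i) (hzero : ∀ i, n ≤ i → w i = 0) :
    ∑ k ∈ range n, rayleigh x w N (orthPoly x w N k) = ∑ i ∈ range n, x i := by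
  have hw : ∀ i, 0 ≤ w i := fun i =>
    (lt_or_ge i n).elim (fun h => (hpos i h).le) fun h => (hzero i h).ge
  have hp := fun k hk => form_orthPoly_self_pos (k := k) hx hn hw hpos hk
  have hU := basisMatrix_transpose_mul hx hn hpos hzero
  have htr : trace ((basisMatrix x w N n)ᵀ * diagonal (fun i : Fin n => x i) *
      basisMatrix x w N n) = ∑ i : Fin n, x i := by
    rw [mul_assoc, trace_mul_comm, mul_assoc, mul_eq_one_comm.1 hU, mul_one, trace_diagonal]
  rw [← Fin.sum_univ_eq_sum_range x, ← htr, trace,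
    ← Fin.sum_univ_eq_sum_range (fun k => rayleigh x w N (orthPoly x w N k))]
  refine sum_congr rfl fun k _ => ?_
  rw [diag_apply, basisMatrix_conj_apply hw hn hzero, Real.mul_self_sqrt (hp k k.2).le, rayleigh]

/-! ### Weights with nonvanishing diagonal -/

lemma continuousAt_form {W : ℝ → ℕ → ℝ} {F G : ℝ → ℝ[X]}
    (hW : ∀ i, ContinuousAt (fun ε => W ε i) 0) (hF : ∀ t, ContinuousAt (fun ε => (F ε).eval t) 0)
    (hG : ∀ t, ContinuousAt (fun ε => (G ε).eval t) 0) :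
    ContinuousAt (fun ε => form x (W ε) N (F ε) (G ε)) 0 :=
  tendsto_finsetSum _ fun i _ => (hW i).mul ((hF (x i)).mul (hG (x i)))

lemma continuousAt_rayleigh {W : ℝ → ℕ → ℝ} {F : ℝ → ℝ[X]}
    (hW : ∀ i, ContinuousAt (fun ε => W ε i) 0) (hF : ∀ t, ContinuousAt (fun ε => (F ε).eval t) 0)
    (hne : form x (W 0) N (F 0) (F 0) ≠ 0) :
    ContinuousAt (fun ε => rayleigh x (W ε) N (F ε)) 0 := by
  refine (continuousAt_form hW (fun t => ?_) hF).div (continuousAt_form hW hF hF) hne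
  simp only [eval_mul, eval_X]
  exact continuousAt_const.mul (hF t)

lemma continuousAt_eval_orthPoly {W : ℝ → ℕ → ℝ} {n : ℕ}
    (hW : ∀ i, ContinuousAt (fun ε => W ε i) 0)
    (hne : ∀ k < n, form x (W 0) N (orthPoly x (W 0) N k) (orthPoly x (W 0) N k) ≠ 0) :
    ∀ k ≤ n, ∀ t, ContinuousAt (fun ε => (orthPoly x (W ε) N k).eval t) 0 := by
  intro k
  induction k using Nat.strong_induction_on with
  | _ k ih =>
    intro hk t
    match k with
    | 0 => simpa [orthPoly] using continuousAt_const
    | 1 =>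
      have h := continuousAt_rayleigh (F := fun ε => orthPoly x (W ε) N 0) hW
        (ih 0 (by omega) (by omega)) (hne 0 (by omega))
      simp only [orthPoly] at h
      simp only [orthPoly, eval_sub, eval_X, eval_C]
      exact continuousAt_const.sub h
    | k + 2 =>
      have h1 := ih (k + 1) (by omega) (by omega)
      have h0 := ih k (by omega) (by omega)
      simp only [orthPoly, eval_sub, eval_mul, eval_X, eval_C]
      exact ((continuousAt_const.sub (continuousAt_rayleigh hW h1 (hne _ (by omega)))).mul
        (h1 t)).sub (((continuousAt_form hW h1 h1).div (continuousAt_form hW h0 h0)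
          (hne _ (by omega))).mul (h0 t))

/-- For distinct nonzero points there are weights whose Jacobi matrix has nonvanishing diagonal:
the points are added one after the other, each with a small enough weight. -/
lemma exists_weights (hx : Function.Injective x) (hx0 : ∀ i, x i ≠ 0) (n : ℕ) (hn : n ≤ N) :
    ∃ w : ℕ → ℝ, (∀ i < n, 0 < w i) ∧ (∀ i, n ≤ i → w i = 0) ∧
      ∀ k < n, rayleigh x w N (orthPoly x w N k) ≠ 0 := by
  induction n with
  | zero => exact ⟨0, by simp, by simp, by simp⟩
  | succ n ih =>
    obtain ⟨w, hpos, hzero, hray⟩ := ih (by omega)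
    have hw : ∀ i, 0 ≤ w i := fun i =>
      (lt_or_ge i n).elim (fun h => (hpos i h).le) fun h => (hzero i h).ge
    let W : ℝ → ℕ → ℝ := fun ε => Function.update w n ε
    have hW0 : W 0 = w := by
      rw [← hzero n le_rfl]; exact Function.update_eq_self n w
    have hW : ∀ i, ContinuousAt (fun ε => W ε i) 0 := by
      intro i
      by_cases hi : i = n
      · subst hi
        simp only [W, Function.update_self]
        exact continuousAt_id
      · simpa [W, hi] using continuousAt_const
    have hne : ∀ k < n, form x (W 0) N (orthPoly x (W 0) N k) (orthPoly x (W 0) N k) ≠ 0 := by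
      intro k hk
      rw [hW0]
      exact (form_orthPoly_self_pos hx (by omega) hw hpos hk).ne'
    have hcont : ∀ k < n, ContinuousAt (fun ε => rayleigh x (W ε) N (orthPoly x (W ε) N k)) 0 :=
      fun k hk => continuousAt_rayleigh hW (continuousAt_eval_orthPoly hW hne k hk.le) (hne k hk)
    have hWpos : ∀ ε > 0, ∀ i < n + 1, 0 < W ε i := by
      intro ε hε i hi
      by_cases h : i = n
      · subst h; simpa [W] using hε
      · simpa [W, h] using hpos i (by omega)
    have hWzero : ∀ ε, ∀ i, n + 1 ≤ i → W ε i = 0 := by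
      intro ε i hi
      have h : i ≠ n := by omega
      simpa [W, h] using hzero i (by omega)
    -- The last Rayleigh quotient has a denominator that degenerates at `ε = 0`, so it is read off
    -- from the trace instead; this expression tends to `x n ≠ 0`.
    have hsum : ContinuousAt (fun ε => ∑ i ∈ range (n + 1), x i -
        ∑ k ∈ range n, rayleigh x (W ε) N (orthPoly x (W ε) N k)) 0 :=
      continuousAt_const.sub (tendsto_finsetSum _ fun k hk => hcont k (mem_range.1 hk))
    have hsum0 : ∑ i ∈ range (n + 1), x i -
        ∑ k ∈ range n, rayleigh x (W 0) N (orthPoly x (W 0) N k) ≠ 0 := by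
      rw [hW0, sum_rayleigh_orthPoly hx (by omega) hpos hzero, sum_range_succ, add_sub_cancel_left]
      exact hx0 n
    have hev : ∀ᶠ ε in nhds (0 : ℝ),
        ∀ k ∈ range n, rayleigh x (W ε) N (orthPoly x (W ε) N k) ≠ 0 :=
      (Filter.eventually_all_finset _).2 fun k hk =>
        (hcont k (mem_range.1 hk)).eventually_ne (by rw [hW0]; exact hray k (mem_range.1 hk))
    obtain ⟨ε, ⟨h1, h2⟩, hε⟩ := (((hev.and (hsum.eventually_ne hsum0)).filter_mono
      nhdsWithin_le_nhds).and (self_mem_nhdsWithin (s := Set.Ioi (0 : ℝ)))).exists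
    refine ⟨W ε, hWpos ε hε, hWzero ε, fun k hk => ?_⟩
    rcases (by omega : k < n ∨ k = n) with h | rfl
    · exact h1 k (mem_range.2 h)
    · rwa [← sum_rayleigh_orthPoly hx hn (hWpos ε hε) (hWzero ε), sum_range_succ,
        add_sub_cancel_left] at h2

/-- Any `n` distinct nonzero reals form the spectrum of a matrix of the path on `n` vertices with
nonvanishing diagonal. -/
theorem exists_path_matrix (hx : Function.Injective x) (hx0 : ∀ i, x i ≠ 0) (n : ℕ) :
    ∃ U : Matrix (Fin n) (Fin n) ℝ, Uᵀ * U = 1 ∧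
      Uᵀ * diagonal (fun i : Fin n => x i) * U ∈ (SimpleGraph.pathGraph n).symmMatrices ∧
      ∀ i, (Uᵀ * diagonal (fun i : Fin n => x i) * U) i i ≠ 0 := by
  obtain ⟨w, hpos, hzero, hray⟩ := exists_weights (N := n) hx hx0 n le_rfl
  have hw : ∀ i, 0 ≤ w i := fun i =>
    (lt_or_ge i n).elim (fun h => (hpos i h).le) fun h => (hzero i h).ge
  have hp := fun k hk => form_orthPoly_self_pos (k := k) hx le_rfl hw hpos hk
  have hne := fun k hk => (hp k hk).ne'
  have hsymm : ((basisMatrix x w n n)ᵀ * diagonal (fun i : Fin n => x i) *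
      basisMatrix x w n n).IsSymm := by
    rw [Matrix.IsSymm, transpose_mul, transpose_mul, transpose_transpose, diagonal_transpose,
      mul_assoc]
  refine ⟨basisMatrix x w n n, basisMatrix_transpose_mul hx le_rfl hpos hzero, ⟨hsymm, ?_⟩, ?_⟩
  · have key : ∀ i j : Fin n, i < j → (((basisMatrix x w n n)ᵀ *
        diagonal (fun i : Fin n => x i) * basisMatrix x w n n) i j ≠ 0 ↔ (i : ℕ) + 1 = j) := by
      intro i j hij
      rw [basisMatrix_conj_apply hw le_rfl hzero]
      have hd : √(form x w n (orthPoly x w n i) (orthPoly x w n i)) *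
          √(form x w n (orthPoly x w n j) (orthPoly x w n j)) ≠ 0 :=
        mul_ne_zero (Real.sqrt_pos.2 (hp i i.2)).ne' (Real.sqrt_pos.2 (hp j j.2)).ne'
      rw [div_ne_zero_iff, and_iff_left hd]
      constructor
      · intro h
        by_contra h'
        exact h (form_X_mul_orthPoly_eq_zero hne (by omega) j.2.le)
      · intro h
        rw [← h, form_X_mul_orthPoly_succ hne (by omega)]
        exact hne _ (by omega)
    intro i j hij
    rw [SimpleGraph.pathGraph_adj]
    rcases hij.lt_or_gt with h | h
    · rw [key i j h]; omega
    · rw [← hsymm.apply, key j i h]; omega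
  · intro i
    rw [basisMatrix_conj_apply hw le_rfl hzero, Real.mul_self_sqrt (hp i i.2).le]
    exact hray i i.2

end DiscreteOrthogonal

/-! ### Lower bound: long diagonal paths force many eigenvalues -/

/-- By the spectral theorem there is a basis of eigenvectors, each killed by one of the factors. -/
lemma Matrix.IsSymm.aeval_prod_distinctEigenvalues {V : Type*} [Fintype V] [DecidableEq V]
    {A : Matrix V V ℝ} (hA : A.IsSymm) :
    aeval A (∏ μ ∈ A.finite_distinctEigenvalues.toFinset, (X - C μ)) = 0 := by
  have hH : A.IsHermitian := by
    rw [Matrix.IsHermitian, conjTranspose_eq_transpose_of_trivial]; exact hA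
  set f : ℝ[X] := ∏ μ ∈ A.finite_distinctEigenvalues.toFinset, (X - C μ)
  have key : aeval (Matrix.toLin' A) f = 0 := by
    refine (hH.eigenvectorBasis.toBasis.map (WithLp.linearEquiv 2 ℝ (V → ℝ))).ext fun j => ?_
    set v := hH.eigenvectorBasis j with hv
    have hne : v.ofLp ≠ 0 := by
      intro h
      exact hH.eigenvectorBasis.orthonormal.ne_zero j (by ext i; exact congrFun h i)
    have hev : Module.End.HasEigenvector (Matrix.toLin' A) (hH.eigenvalues j) v.ofLp := by
      refine ⟨Module.End.mem_eigenspace_iff.2 ?_, hne⟩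
      rw [Matrix.toLin'_apply]
      exact hH.mulVec_eigenvectorBasis j
    have h0 : f.eval (hH.eigenvalues j) = 0 := by
      rw [eval_prod]
      refine prod_eq_zero (i := hH.eigenvalues j) ?_ (by simp)
      rw [Set.Finite.mem_toFinset]
      exact Module.End.hasEigenvalue_of_hasEigenvector hev
    have := Module.End.aeval_apply_of_hasEigenvector (p := f) hev
    rw [h0, zero_smul] at this
    simpa using this
  have h2 : Matrix.toLinAlgEquiv' (aeval A f) = 0 := by
    rw [← Polynomial.aeval_algHom_apply (Matrix.toLinAlgEquiv' (R := ℝ) (n := V)) A f]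
    exact key
  simpa using h2

namespace SimpleGraph

variable {s s' : ℕ} {A : Matrix (Fin s × Fin s') (Fin s × Fin s') ℝ}

lemma apply_ne_zero_of_mem_symmMatrices
    (hA : A ∈ ((pathGraph s).strongProd (pathGraph s')).symmMatrices) {y z : Fin s × Fin s'}
    (h : A y z ≠ 0) : (z.1 : ℕ) ≤ y.1 + 1 ∧ (z.2 : ℕ) ≤ y.2 + 1 := by
  by_cases hyz : y = z
  · subst hyz; omega
  · have := (hA.2 y z hyz).1 h
    simp only [strongProd, pathGraph_adj, Fin.ext_iff] at this
    omega

lemma le_of_pow_apply_ne_zero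
    (hA : A ∈ ((pathGraph s).strongProd (pathGraph s')).symmMatrices) {o : Fin s × Fin s'}
    (ho : (o.1 : ℕ) = 0 ∧ (o.2 : ℕ) = 0) (k : ℕ) :
    ∀ z, (A ^ k) o z ≠ 0 → (z.1 : ℕ) ≤ k ∧ (z.2 : ℕ) ≤ k := by
  induction k with
  | zero =>
    intro z hz
    have : o = z := by
      by_contra h
      exact hz (by rw [pow_zero, one_apply_ne h])
    subst this
    omega
  | succ k ih =>
    intro z hz
    rw [pow_succ, mul_apply] at hz
    obtain ⟨y, -, hy⟩ := exists_ne_zero_of_sum_ne_zero hz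
    have h1 := ih y (left_ne_zero_of_mul hy)
    have h2 := apply_ne_zero_of_mem_symmMatrices hA (right_ne_zero_of_mul hy)
    omega

/-- A step raises each coordinate by at most one, so only `(k, k)` can precede `(k + 1, k + 1)` at
step `k`; with a single walk contributing, no cancellation can occur. -/
lemma pow_apply_diag_ne_zero
    (hA : A ∈ ((pathGraph s).strongProd (pathGraph s')).symmMatrices) {o : Fin s × Fin s'}
    (ho : (o.1 : ℕ) = 0 ∧ (o.2 : ℕ) = 0) (k : ℕ) :
    ∀ z, (z.1 : ℕ) = k → (z.2 : ℕ) = k → (A ^ k) o z ≠ 0 := by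
  induction k with
  | zero =>
    intro z h1 h2
    have : o = z := by
      ext <;> omega
    rw [this, pow_zero, one_apply_eq]
    exact one_ne_zero
  | succ k ih =>
    intro z h1 h2
    let y : Fin s × Fin s' := (⟨k, by omega⟩, ⟨k, by omega⟩)
    rw [pow_succ, mul_apply, sum_eq_single y]
    · refine mul_ne_zero (ih y rfl rfl) ((hA.2 y z ?_).2 ?_)
      · intro h
        have : (y.1 : ℕ) = z.1 := by rw [h]
        simp [y] at this
        omega
      · simp only [strongProd, pathGraph_adj, y]
        omega
    · intro u _ hu
      by_contra h
      have h3 := le_of_pow_apply_ne_zero hA ho k u (left_ne_zero_of_mul h)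
      have h4 := apply_ne_zero_of_mem_symmMatrices hA (right_ne_zero_of_mul h)
      exact hu (by ext <;> simp only [y] <;> omega)
    · simp

lemma le_numDistinctEigenvalues (hss' : s ≤ s')
    (hA : A ∈ ((pathGraph s).strongProd (pathGraph s')).symmMatrices) :
    s ≤ A.numDistinctEigenvalues := by
  by_contra! hlt
  set m := A.numDistinctEigenvalues with hm
  set f : ℝ[X] := ∏ μ ∈ A.finite_distinctEigenvalues.toFinset, (X - C μ) with hf
  have hmon : f.Monic := monic_prod_of_monic _ _ fun μ _ => monic_X_sub_C μ
  have hdeg : f.natDegree = m := by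
    rw [hf, natDegree_finsetProd_X_sub_C_eq_card, hm, Matrix.numDistinctEigenvalues,
      Set.ncard_eq_toFinset_card _ A.finite_distinctEigenvalues]
  have h0 : aeval A f = 0 := hA.1.aeval_prod_distinctEigenvalues
  let o : Fin s × Fin s' := (⟨0, by omega⟩, ⟨0, by omega⟩)
  -- This is a vertex because `m < s ≤ s'`; in the entry at `(o, z)` only the leading term of `f`
  -- survives.
  let z : Fin s × Fin s' := (⟨m, by omega⟩, ⟨m, by omega⟩)
  have h1 : aeval A f o z = 0 := by rw [h0]; rfl
  rw [aeval_eq_sum_range, hdeg, sum_range_succ, ← hdeg, hmon.coeff_natDegree, hdeg, one_smul,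
    Matrix.add_apply, Matrix.sum_apply, sum_eq_zero, zero_add] at h1
  · exact pow_apply_diag_ne_zero hA (o := o) ⟨rfl, rfl⟩ m z rfl rfl h1
  · intro k hk
    rw [Matrix.smul_apply, smul_eq_mul, mul_eq_zero]
    right
    by_contra h
    have h2 := le_of_pow_apply_ne_zero hA (o := o) ⟨rfl, rfl⟩ k z h
    have h3 := mem_range.1 hk
    have h4 : (z.1 : ℕ) = m := rfl
    omega

/-! ### Upper bound: Kronecker products -/

/-- The nonzero diagonals supply exactly the edges along which one coordinate is constant. -/
lemma kronecker_mem_symmMatrices {V W : Type*} {G : SimpleGraph V} {H : SimpleGraph W}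
    {A : Matrix V V ℝ} {B : Matrix W W ℝ} (hA : A ∈ G.symmMatrices) (hB : B ∈ H.symmMatrices)
    (hA0 : ∀ i, A i i ≠ 0) (hB0 : ∀ i, B i i ≠ 0) :
    A ⊗ₖ B ∈ (G.strongProd H).symmMatrices := by
  refine ⟨?_, ?_⟩
  · rw [Matrix.IsSymm, ← kroneckerMap_transpose, hA.1.eq, hB.1.eq]
  · rintro ⟨i, i'⟩ ⟨j, j'⟩ hij
    simp only [kroneckerMap_apply, mul_ne_zero_iff, strongProd]
    by_cases h : i = j
    · subst h
      have h' : i' ≠ j' := fun h' => hij (by rw [h'])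
      simp [hA0, hB.2 _ _ h', h']
    · by_cases h' : i' = j'
      · subst h'
        simp [hB0, hA.2 _ _ h, h]
      · simp [hA.2 _ _ h, hB.2 _ _ h', h, h', and_comm]

end SimpleGraph

lemma Matrix.distinctEigenvalues_conj_diagonal_subset {V : Type*} [Fintype V] [DecidableEq V]
    {U : Matrix V V ℝ} (hU : Uᵀ * U = 1) (d : V → ℝ) :
    (Uᵀ * diagonal d * U).distinctEigenvalues ⊆ Set.range d := by
  intro μ hμ
  obtain ⟨v, hv, hv0⟩ := Module.End.HasEigenvalue.exists_hasEigenvector hμ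
  rw [Module.End.mem_eigenspace_iff, Matrix.toLin'_apply] at hv
  have hne : U *ᵥ v ≠ 0 := fun h => hv0 (by
    rw [← one_mulVec v, ← hU, ← mulVec_mulVec, h, mulVec_zero])
  have h1 : diagonal d *ᵥ (U *ᵥ v) = μ • (U *ᵥ v) := by
    rw [← mulVec_smul, ← hv, mulVec_mulVec, mulVec_mulVec, ← mul_assoc, ← mul_assoc,
      mul_eq_one_comm.1 hU, one_mul]
  obtain ⟨i, hi⟩ := Function.ne_iff.1 hne
  refine ⟨i, mul_right_cancel₀ hi ?_⟩
  have := congrFun h1 i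
  rwa [mulVec_diagonal] at this

namespace SimpleGraph

/-- If all products `x i * x j` with `i < s`, `j < s'` lie in `T`, then `q(P_s ⊠ P_{s'}) ≤ |T|`. -/
lemma minDistinctEigenvalues_strongProd_pathGraph_le {x : ℕ → ℝ} (hx : Function.Injective x)
    (hx0 : ∀ i, x i ≠ 0) {s s' : ℕ} {T : Finset ℝ} (hT : ∀ i < s, ∀ j < s', x i * x j ∈ T) :
    ((pathGraph s).strongProd (pathGraph s')).minDistinctEigenvalues ≤ #T := by
  obtain ⟨U, hU, hA, hA0⟩ := DiscreteOrthogonal.exists_path_matrix hx hx0 s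
  obtain ⟨U', hU', hB, hB0⟩ := DiscreteOrthogonal.exists_path_matrix hx hx0 s'
  refine ((isLeast_minDistinctEigenvalues _).2
    ⟨_, kronecker_mem_symmMatrices hA hB hA0 hB0, rfl⟩).trans ?_
  rw [mul_kronecker_mul, mul_kronecker_mul, diagonal_kronecker_diagonal, kroneckerMap_transpose,
    Matrix.numDistinctEigenvalues, ← Set.ncard_coe_finset]
  refine Set.ncard_le_ncard ((Matrix.distinctEigenvalues_conj_diagonal_subset ?_ _).trans ?_)
    T.finite_toSet
  · rw [← kroneckerMap_transpose, ← mul_kronecker_mul, hU, hU', one_kronecker_one]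
  · rintro _ ⟨⟨i, j⟩, rfl⟩
    exact hT i i.2 j j.2

end SimpleGraph

/-- The sequence is `1, -1, 2, -2, 4, -4, …`: the absolute value determines `i / 2` and the sign the
parity of `i`. -/
lemma injective_neg_one_pow_mul_two_pow :
    Function.Injective fun i : ℕ => (-1 : ℝ) ^ i * 2 ^ (i / 2) := by
  intro i j h
  simp only at h
  have h1 : i / 2 = j / 2 := by
    have := congrArg abs h
    simp only [abs_mul, abs_pow, abs_neg, abs_one, one_pow, one_mul, Nat.abs_ofNat] at this
    exact pow_right_injective₀ (by norm_num) (by norm_num) this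
  rw [h1] at h
  have h2 : (-1 : ℝ) ^ i = (-1) ^ j := mul_right_cancel₀ (by positivity) h
  rcases Nat.even_or_odd i with hi | hi <;> rcases Nat.even_or_odd j with hj | hj
  · grind
  · rw [hi.neg_one_pow, hj.neg_one_pow] at h2; norm_num at h2
  · rw [hi.neg_one_pow, hj.neg_one_pow] at h2; norm_num at h2
  · grind

theorem mainTheorem11 (s s' : ℕ) (hs : 2 ≤ s) (hss' : s ≤ s') :
    s ≤ ((SimpleGraph.pathGraph s).strongProd (SimpleGraph.pathGraph s')).minDistinctEigenvalues ∧
    ((SimpleGraph.pathGraph s).strongProd (SimpleGraph.pathGraph s')).minDistinctEigenvalues ≤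
      (if Even s ∧ Even s' then s + s' - 2 else s + s' - 1) := by
  constructor
  · obtain ⟨A, hA, h⟩ := (SimpleGraph.isLeast_minDistinctEigenvalues
      ((SimpleGraph.pathGraph s).strongProd (SimpleGraph.pathGraph s'))).1
    rw [← h]
    exact SimpleGraph.le_numDistinctEigenvalues hss' hA
  · split_ifs with he
    · obtain ⟨⟨a, ha⟩, b, hb⟩ := he
      refine (SimpleGraph.minDistinctEigenvalues_strongProd_pathGraph_le
        injective_neg_one_pow_mul_two_pow (fun i => by positivity)
        (T := (range (s + s' - 2)).image fun i : ℕ => (-1 : ℝ) ^ i * 2 ^ (i / 2)) ?_).trans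
        (card_image_le.trans (card_range _).le)
      intro i hi j hj
      -- Exponents add and signs multiply. As `s` and `s'` are even, `i / 2 + j / 2 ≤ s / 2 + s' / 2
      -- - 2`, which keeps the index below `s + s' - 2`.
      refine mem_image.2 ⟨2 * (i / 2 + j / 2) + (i + j) % 2, mem_range.2 (by omega), ?_⟩
      have h1 : (2 * (i / 2 + j / 2) + (i + j) % 2) / 2 = i / 2 + j / 2 := by omega
      have h2 : (-1 : ℝ) ^ (2 * (i / 2 + j / 2) + (i + j) % 2) = (-1) ^ (i + j) := by
        rw [pow_add, pow_mul, neg_one_sq, one_pow, one_mul, ← neg_one_pow_eq_pow_mod_two]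
      rw [h1, h2]
      ring
    · refine (SimpleGraph.minDistinctEigenvalues_strongProd_pathGraph_le
        (x := fun i => 2 ^ i) (pow_right_injective₀ (by norm_num) (by norm_num))
        (fun i => by positivity)
        (T := (range (s + s' - 1)).image fun i : ℕ => (2 : ℝ) ^ i) ?_).trans
        (card_image_le.trans (card_range _).le)
      intro i hi j hj
      exact mem_image.2 ⟨i + j, mem_range.2 (by omega), pow_add _ _ _⟩
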